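/- Let $(X,J,g,\omega)$ be a compact $2n$-dimensional almost-Hermitian manifold with $n\ge 2$: $J$ is a smooth almost-complex structure, $g$ a smooth Riemannian metric with $g(J\cdot,J\cdot)=g$, and $\omega=g(J\cdot,\cdot)$. Let $A^{p,q}$ be the space of smooth complex $(p,q)$-forms, $*$ the $\mathbb{C}$-linear Hodge operator of $g$ (with the orientation induced by $J$), and let $\partial$ and $\bar\partial$ be the components of $d$ of bidegree $(1,0)$ and $(0,1)$. Put $\partial^*=-*\bar\partial*$, $\bar\partial^*=-*\partial*$, $\Delta_{\partial}=\partial\partial^*+\partial^*\partial$, $\Delta_{\bar\partial}=\bar\partial\bar\partial^*+\bar\partial^*\bar\partial$, and, for $D\in\{\partial,\bar\partial\}$, $\mathcal{H}^{p,q}_D=\ker(\Delta_D|_{A^{p,q}})$. Let $L\alpha=\omega\wedge\alpha$, $\Lambda=-*L*$, and let $P^{p,q}=\{\alpha\in A^{p,q}:\Lambda\alpha=0\}$ be the space of primitive $(p,q)$-forms. Then, for all $p,q\le n$, $$\mathcal{H}^{p,0}_{\bar\partial}=\mathcal{H}^{p,0}_{\bar\partial}\cap P^{p,0},\qquad \mathcal{H}^{0,q}_{\bar\partial}=\mathcal{H}^{0,q}_{\bar\partial}\cap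 P^{0,q},$$ $$\mathcal{H}^{p,0}_{\partial}=\mathcal{H}^{p,0}_{\partial}\cap P^{p,0},\qquad \mathcal{H}^{0,q}_{\partial}=\mathcal{H}^{0,q}_{\partial}\cap P^{0,q}.$$ That is, every $\bar\partial$- or $\partial$-harmonic $(p,0)$- or $(0,q)$-form is primitive. -/

import Mathlib

open scoped Manifold ContDiff

noncomputable section

namespace AlmostHermitian

/-! ### Complex exterior algebra of a real vector space -/

section Pointwise

variable {V : Type*} [AddCommGroup V] [Module ℝ V] [TopologicalSpace V]

/-- Complex-valued real-multilinear alternating `k`-forms on `V`, i.e. `Λ^k V^* ⊗ ℂ`. -/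
abbrev KForm (V : Type*) [AddCommGroup V] [Module ℝ V] [TopologicalSpace V] (k : ℕ) : Type _ :=
  V [⋀^Fin k]→L[ℝ] ℂ

/-- The full complex exterior algebra `Λ^• V^* ⊗ ℂ`: one component in each degree (for
finite-dimensional `V` the components in degrees `> dim V` vanish, so this is the direct sum). -/
abbrev Forms (V : Type*) [AddCommGroup V] [Module ℝ V] [TopologicalSpace V] : Type _ :=
  ∀ k : ℕ, KForm V k

/-- The wedge product `c 0 ∧ ⋯ ∧ c (k-1)` of complex covectors,
`(v_0, …, v_{k-1}) ↦ det (c i (v j))`. -/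
def wedgeCovectors {k : ℕ} (c : Fin k → (V →L[ℝ] ℂ)) : KForm V k :=
  ContinuousMultilinearMap.alternatization
    ((ContinuousMultilinearMap.mkPiAlgebra ℝ (Fin k) ℂ).compContinuousLinearMap c)

theorem wedgeCovectors_apply {k : ℕ} (c : Fin k → (V →L[ℝ] ℂ)) (v : Fin k → V) :
    wedgeCovectors c v = (Matrix.of fun i j => c i (v j)).det := by
  simp only [wedgeCovectors, ContinuousMultilinearMap.alternatization_apply_apply,
    ContinuousMultilinearMap.compContinuousLinearMap_apply,
    ContinuousMultilinearMap.mkPiAlgebra_apply, Function.comp]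
  rw [← Matrix.det_transpose, Matrix.det_apply]
  rfl

/-- `(v_0, …, v_{m-1}) ↦ α (v_0, …, v_{i-1}) * β (v_i, …, v_{m-1})`, where `m = i + j`. -/
def tensorForm {i j m : ℕ} (h : i + j = m) (α : KForm V i) (β : KForm V j) :
    ContinuousMultilinearMap ℝ (fun _ : Fin m => V) ℂ where
  toMultilinearMap := ((LinearMap.mul' ℝ ℂ).compMultilinearMap
    (MultilinearMap.domCoprod α.toMultilinearMap β.toMultilinearMap)).domDomCongr
      (finSumFinEquiv.trans (finCongr h))
  cont := by
    change Continuous fun v : Fin m → V =>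
      α (fun a => v (finCongr h (finSumFinEquiv (Sum.inl a)))) *
        β (fun b => v (finCongr h (finSumFinEquiv (Sum.inr b))))
    exact (α.cont.comp (by fun_prop)).mul (β.cont.comp (by fun_prop))

theorem tensorForm_apply {i j m : ℕ} (h : i + j = m) (α : KForm V i) (β : KForm V j)
    (v : Fin m → V) :
    tensorForm h α β v = α (fun a => v (Fin.cast h (Fin.castAdd j a))) *
      β (fun b => v (Fin.cast h (Fin.natAdd i b))) := rfl

/-- The wedge product of an `i`-form and a `j`-form, as an `m`-form with `m = i + j`:
`(α ∧ β)(v) = 1 / (i! j!) * ∑_σ sign σ * α (v_{σ 0}, …, v_{σ (i-1)}) * β (v_{σ i}, …)`. -/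
def wedge {i j m : ℕ} (h : i + j = m) (α : KForm V i) (β : KForm V j) : KForm V m :=
  ((i.factorial * j.factorial : ℕ) : ℂ)⁻¹ •
    ContinuousMultilinearMap.alternatization (tensorForm h α β)

/-- The Lefschetz operator `α ↦ ω ∧ α`. -/
def lefschetz (om : KForm V 2) (α : Forms V) : Forms V
  | 0 => 0
  | 1 => 0
  | k + 2 => wedge (Nat.add_comm 2 k) om (α k)

/-- The interior product `ι_v α = α (v, ·, …, ·)` on `(k+1)`-forms. -/
def interiorProd {k : ℕ} (v : V) (α : KForm V (k + 1)) : KForm V k where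
  toFun w := α (Matrix.vecCons v w)
  map_update_add' w i x y := by
    rename_i hdec
    rw [Subsingleton.elim hdec (instDecidableEqFin k)]
    simp only [Matrix.vecCons, Fin.cons_update]
    exact α.map_update_add _ _ _ _
  map_update_smul' w i c x := by
    rename_i hdec
    rw [Subsingleton.elim hdec (instDecidableEqFin k)]
    simp only [Matrix.vecCons, Fin.cons_update]
    exact α.map_update_smul _ _ _ _
  map_eq_zero_of_eq' w i j hw hij :=
    α.map_eq_zero_of_eq (i := i.succ) (j := j.succ) _ (by simpa using hw) (by simpa using hij)
  cont := α.cont.comp (by unfold Matrix.vecCons; fun_prop)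

/-- `contract [v_0, …, v_{a-1}] β = β (v_0, …, v_{a-1}, ·, …, ·)`. -/
def contract (l : List V) (β : Forms V) : Forms V :=
  l.foldl (fun γ v k => interiorProd v (γ (k + 1))) β

/-- The `ℂ`-linear Hodge star with respect to a frame `b` and a volume form `vol` of degree `m`:
on an `a`-form,
`(* α)(w) = 1 / a! * ∑_{s : Fin a → Fin m} α (b_{s 0}, …, b_{s (a-1)}) *
  vol (b_{s 0}, …, b_{s (a-1)}, w)`.
For an orthonormal frame `b` and the corresponding volume form, this is the `ℂ`-linear extension
of the usual Hodge star, characterised by `α ∧ * β = ⟨α, β⟩ vol` on real forms. -/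
def hodgeStar {m : ℕ} (b : Fin m → V) (vol : KForm V m) (α : Forms V) : Forms V :=
  ∑ a ∈ Finset.range (m + 1), ((a.factorial : ℂ)⁻¹) •
    ∑ s : Fin a → Fin m,
      α a (b ∘ s) • contract (List.ofFn (b ∘ s)) (Pi.single m vol)

/-- `Λ^{p,q} V^*`, the complex span of the forms
`a_1 ∧ ⋯ ∧ a_p ∧ c_1 ∧ ⋯ ∧ c_q` with `a_i` of type `(1,0)` (that is, `a_i ∘ J = i a_i`)
and `c_j` of type `(0,1)` (that is, `c_j ∘ J = -i c_j`). -/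
def typeSubmodule (J : V →L[ℝ] V) (p q : ℕ) : Submodule ℂ (KForm V (p + q)) :=
  Submodule.span ℂ {α | ∃ (a : Fin p → (V →L[ℝ] ℂ)) (c : Fin q → (V →L[ℝ] ℂ)),
    (∀ i v, a i (J v) = Complex.I * a i v) ∧ (∀ j v, c j (J v) = -Complex.I * c j v) ∧
    α = wedgeCovectors (Fin.append a c)}

section Projection

variable [IsTopologicalAddGroup V] [ContinuousSMul ℝ V]

/-- The rotation `cos θ + sin θ J`, i.e. multiplication by `e^{iθ}` on `(V, J)`. -/
def rotation (J : V →L[ℝ] V) (θ : ℝ) : V →L[ℝ] V :=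
  Real.cos θ • ContinuousLinearMap.id ℝ V + Real.sin θ • J

/-- The projection `Π^{p,q}` of `Λ^k V^* ⊗ ℂ = ⨁_{p+q=k} Λ^{p,q} V^*` onto `Λ^{p,q} V^*`
(for `p + q = k`). Pull-back by `cos θ + sin θ J` acts on `Λ^{r,s} V^*` as multiplication by
`e^{iθ(r-s)}`; averaging against `e^{-iθ(p-q)}` over the angles `θ = π j / (k+1)`, `j = 0, …, k`,
keeps `Λ^{p,q} V^*` and kills the other summands: see `typeProj_of_mem`,
`typeProj_of_mem_of_ne` and `sum_typeProj`. -/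
def typeProj (J : V →L[ℝ] V) (p q : ℕ) {k : ℕ} (α : KForm V k) : KForm V k :=
  ((k : ℂ) + 1)⁻¹ • ∑ j ∈ Finset.range (k + 1),
    Complex.exp (-(Real.pi * j / (k + 1) * ((p : ℂ) - q)) * Complex.I) •
      α.compContinuousLinearMap (rotation J (Real.pi * j / (k + 1)))

theorem typeProj_of_mem_aux {J : V →L[ℝ] V} {r s : ℕ} {α : KForm V (r + s)}
    (hα : α ∈ typeSubmodule J r s) (θ : ℝ) :
    α.compContinuousLinearMap (rotation J θ) =
      Complex.exp (θ * ((r : ℂ) - s) * Complex.I) • α := by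
  have hexp1 : Complex.exp (θ * Complex.I) = Complex.cos θ + Complex.sin θ * Complex.I :=
    Complex.exp_mul_I _
  have hexp2 : Complex.exp (-θ * Complex.I) = Complex.cos θ - Complex.sin θ * Complex.I := by
    rw [Complex.exp_mul_I, Complex.cos_neg, Complex.sin_neg]; ring
  induction hα using Submodule.span_induction with
  | mem α hα =>
    obtain ⟨a, c, ha, hc, rfl⟩ := hα
    have hE : ∀ (i : Fin (r + s)) (v : V), (Fin.append a c : Fin (r + s) → V →L[ℝ] ℂ) i
        (rotation J θ v) = (Fin.append (fun _ : Fin r => Complex.exp (θ * Complex.I))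
          (fun _ : Fin s => Complex.exp (-θ * Complex.I)) : Fin (r + s) → ℂ) i *
          (Fin.append a c : Fin (r + s) → V →L[ℝ] ℂ) i v := by
      intro i v
      refine Fin.addCases (fun i => ?_) (fun i => ?_) i
      · simp [rotation, ha, hexp1]; ring
      · simp only [rotation, hexp2, add_apply, smul_apply,
          map_add, map_smul, Fin.append_right, hc, ContinuousLinearMap.id_apply,
          Complex.real_smul, Complex.ofReal_cos, Complex.ofReal_sin]
        ring
    ext v
    simp only [ContinuousAlternatingMap.compContinuousLinearMap_apply,
      ContinuousAlternatingMap.smul_apply, smul_eq_mul, wedgeCovectors_apply, Function.comp, hE]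
    have hdet := Matrix.det_mul_column (Fin.append (fun _ : Fin r => Complex.exp (θ * Complex.I))
      (fun _ : Fin s => Complex.exp (-θ * Complex.I)) : Fin (r + s) → ℂ)
      (Matrix.of fun i j => (Fin.append a c : Fin (r + s) → V →L[ℝ] ℂ) i (v j))
    simp only [Matrix.of_apply] at hdet
    refine hdet.trans ?_
    congr 1
    rw [Fin.prod_univ_add]
    simp only [Fin.append_left, Fin.append_right, Finset.prod_const, Finset.card_univ,
      Fintype.card_fin, ← Complex.exp_nat_mul, ← Complex.exp_add]
    congr 1
    ring
  | zero => ext v; simp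
  | add x y _ _ hx hy =>
    rw [smul_add, ← hx, ← hy]; rfl
  | smul t x _ hx =>
    rw [smul_comm, ← hx]; rfl

theorem sum_exp_eq (k : ℕ) (d : ℤ) (hd : |d| ≤ k) :
    ∑ j ∈ Finset.range (k + 1), Complex.exp (2 * Real.pi * Complex.I * (j * d / (k + 1))) =
      if d = 0 then (k : ℂ) + 1 else 0 := by
  have hk : (k : ℂ) + 1 ≠ 0 := by exact_mod_cast Nat.succ_ne_zero k
  split_ifs with h
  · simp [h]
  · set z := Complex.exp (2 * Real.pi * Complex.I * (d / (k + 1))) with hz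
    have h1 : ∀ j ∈ Finset.range (k + 1),
        Complex.exp (2 * Real.pi * Complex.I * (j * d / (k + 1))) = z ^ j := by
      intro j _
      rw [hz, ← Complex.exp_nat_mul]; congr 1; ring
    rw [Finset.sum_congr rfl h1]
    have hz1 : z ≠ 1 := by
      intro hz1
      rw [hz, Complex.exp_eq_one_iff] at hz1
      obtain ⟨m, hm⟩ := hz1
      have h2 : (2 * Real.pi * Complex.I : ℂ) ≠ 0 := Complex.two_pi_I_ne_zero
      have h3 : (d : ℂ) / (k + 1) = m := by
        apply mul_left_cancel₀ h2; rw [hm]; ring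
      rw [div_eq_iff hk] at h3
      have h4 : d = m * (k + 1) := by exact_mod_cast h3
      have h5 : m ≠ 0 := by rintro rfl; exact h (by simpa using h4)
      have h6 : 1 ≤ |m| := Int.one_le_abs h5
      have h7 : |d| = |m| * (k + 1) := by
        rw [h4, abs_mul, abs_of_nonneg (a := (k : ℤ) + 1) (by positivity)]
      nlinarith
    have hzk : z ^ (k + 1) = 1 := by
      rw [hz, ← Complex.exp_nat_mul, Complex.exp_eq_one_iff]
      refine ⟨d, ?_⟩
      push_cast
      field_simp
    rw [geom_sum_eq hz1, hzk]; simp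

/-- `Π^{p,q}` is the identity on `Λ^{p,q}`. -/
theorem typeProj_of_mem {J : V →L[ℝ] V} {p q : ℕ} {α : KForm V (p + q)}
    (hα : α ∈ typeSubmodule J p q) : typeProj J p q α = α := by
  have hk : ((p + q : ℕ) : ℂ) + 1 ≠ 0 := by exact_mod_cast Nat.succ_ne_zero (p + q)
  unfold typeProj
  simp only [typeProj_of_mem_aux hα, smul_smul, ← Finset.sum_smul, ← Complex.exp_add]
  rw [Finset.sum_congr rfl (g := fun _ => (1 : ℂ))]
  · simp only [Finset.sum_const, Finset.card_range, nsmul_eq_mul, mul_one]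
    push_cast at hk ⊢
    rw [inv_mul_cancel₀ hk, one_smul]
  · intro j _
    rw [Complex.exp_eq_one_iff]
    exact ⟨0, by push_cast; ring⟩

/-- `Π^{p,q}` vanishes on `Λ^{r,s}` if `r + s = p + q` and `(r,s) ≠ (p,q)`. -/
theorem typeProj_of_mem_of_ne {J : V →L[ℝ] V} {p q r s : ℕ} (h : p + q = r + s) (hne : p ≠ r)
    {α : KForm V (r + s)} (hα : α ∈ typeSubmodule J r s) : typeProj J p q α = 0 := by
  unfold typeProj
  simp only [typeProj_of_mem_aux hα, smul_smul, ← Finset.sum_smul, ← Complex.exp_add]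
  have hd : |(r : ℤ) - p| ≤ (r + s : ℕ) := by rw [abs_le]; push_cast; omega
  have := sum_exp_eq (r + s) ((r : ℤ) - p) hd
  rw [if_neg (by omega)] at this
  rw [Finset.sum_congr rfl (g := fun j : ℕ => Complex.exp (2 * Real.pi * Complex.I *
    (j * ((r : ℤ) - p : ℤ) / ((r + s : ℕ) + 1)))), this]
  · rw [mul_zero]
    ext v
    exact zero_mul _
  intro j _
  congr 1
  have hC : (q : ℂ) = r + s - p := by
    have : ((p + q : ℕ) : ℂ) = (r + s : ℕ) := by rw [h]
    push_cast at this
    linear_combination this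
  rw [hC]
  push_cast
  ring

/-- `∑_{p+q=k} Π^{p,q}` is the identity on `k`-forms. -/
theorem sum_typeProj (J : V →L[ℝ] V) {k : ℕ} (α : KForm V k) :
    ∑ pq ∈ Finset.HasAntidiagonal.antidiagonal k, typeProj J pq.1 pq.2 α = α := by
  have hk : (k : ℂ) + 1 ≠ 0 := by exact_mod_cast Nat.succ_ne_zero k
  unfold typeProj
  rw [← Finset.smul_sum, Finset.sum_comm]
  simp only [← Finset.sum_smul]
  rw [Finset.sum_eq_single 0]
  · have h0 : rotation J (Real.pi * (0 : ℕ) / (k + 1)) = ContinuousLinearMap.id ℝ V := by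
      simp [rotation]
    rw [h0]
    have h1 : α.compContinuousLinearMap (ContinuousLinearMap.id ℝ V) = α := rfl
    rw [h1, smul_smul]
    simp only [Nat.cast_zero, mul_zero, zero_div, zero_mul, neg_zero, Complex.exp_zero,
      Finset.sum_const, Finset.Nat.card_antidiagonal, nsmul_eq_mul, mul_one, Nat.cast_add,
      Nat.cast_one]
    rw [inv_mul_cancel₀ hk, one_smul]
  · intro j hj hj0
    rw [Finset.Nat.sum_antidiagonal_eq_sum_range_succ
      (fun p q : ℕ => Complex.exp (-(Real.pi * j / (k + 1) * ((p : ℂ) - q)) * Complex.I))]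
    have := sum_exp_eq k (-(j : ℤ)) (by
      rw [abs_neg, Nat.abs_cast]; exact_mod_cast Nat.lt_succ_iff.mp (Finset.mem_range.mp hj))
    rw [if_neg (by omega)] at this
    rw [Finset.sum_congr rfl (g := fun p : ℕ => Complex.exp (Real.pi * j * k / (k + 1) *
      Complex.I) * Complex.exp (2 * Real.pi * Complex.I * (p * (-(j : ℤ) : ℤ) / (k + 1)))),
      ← Finset.mul_sum, this, mul_zero, zero_smul]
    intro p hp
    rw [← Complex.exp_add]
    congr 1
    have : ((k - p : ℕ) : ℂ) = k - p :=
      Nat.cast_sub (Nat.lt_succ_iff.mp (Finset.mem_range.mp hp))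
    rw [this]
    push_cast
    field_simp
    ring
  · simp

end Projection

/-- `b` is a unitary frame `e_1, J e_1, …, e_n, J e_n`, orthonormal for `g`. It is positively
oriented for the orientation induced by `J`. -/
def IsUnitaryFrame {V : Type*} {n : ℕ} (g : V → V → ℝ) (J : V → V) (b : Fin (2 * n) → V) : Prop :=
  (∀ i j, g (b i) (b j) = if i = j then 1 else 0) ∧
  ∀ j : Fin n, b ⟨2 * j + 1, by omega⟩ = J (b ⟨2 * j, by omega⟩)

/-- Unitary frames exist for every positive definite symmetric bilinear form `g` with
`g (J u) (J v) = g u v` on a `2n`-dimensional space with complex structure `J`. -/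
theorem exists_isUnitaryFrame {V : Type*} [AddCommGroup V] [Module ℝ V] {n : ℕ}
    [FiniteDimensional ℝ V] (hn : Module.finrank ℝ V = 2 * n)
    (g : V →ₗ[ℝ] V →ₗ[ℝ] ℝ) (J : V →ₗ[ℝ] V) (symm : ∀ u v, g u v = g v u)
    (pos : ∀ v, v ≠ 0 → 0 < g v v) (hJ : ∀ v, J (J v) = -v) (hg : ∀ u v, g (J u) (J v) = g u v) :
    ∃ b : Fin (2 * n) → V, IsUnitaryFrame (fun u v => g u v) J b := by
  have hskew : ∀ u v, g (J u) v = -g u (J v) := by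
    intro u v; rw [← hg u (J v), hJ]; simp
  have hself : ∀ u, g u (J u) = 0 := by
    intro u; have := hskew u u; rw [symm (J u) u] at this; linarith
  have key : ∀ m ≤ n, ∃ e : Fin m → V,
      ∀ i j, g (e i) (e j) = (if i = j then 1 else 0) ∧ g (e i) (J (e j)) = 0 := by
    intro m
    induction m with
    | zero => intro _; exact ⟨fun i => i.elim0, fun i => i.elim0⟩
    | succ m ih =>
      intro hm
      obtain ⟨e, he⟩ := ih (by omega)
      let T : V →ₗ[ℝ] (Fin m ⊕ Fin m → ℝ) :=
        LinearMap.pi (Sum.elim (fun i => g (e i)) (fun i => g (J (e i))))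
      have hker : LinearMap.ker T ≠ ⊥ := by
        apply LinearMap.ker_ne_bot_of_finrank_lt
        simp only [Module.finrank_fintype_fun_eq_card, Fintype.card_sum, Fintype.card_fin, hn]
        omega
      obtain ⟨v, hv, hv0⟩ := (Submodule.ne_bot_iff _).mp hker
      have hT : T v = 0 := hv
      have h1 : ∀ i, g (e i) v = 0 := fun i => congrFun hT (Sum.inl i)
      have h2 : ∀ i, g (e i) (J v) = 0 := fun i => by
        have : g (J (e i)) v = 0 := congrFun hT (Sum.inr i)
        rw [hskew] at this; linarith
      have hp := pos v hv0
      set c : ℝ := (Real.sqrt (g v v))⁻¹ with hc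
      have hcc : c * c * g v v = 1 := by
        rw [hc, ← mul_inv, Real.mul_self_sqrt hp.le, inv_mul_cancel₀ hp.ne']
      refine ⟨Fin.snoc e (c • v), fun i j => ?_⟩
      refine Fin.lastCases ?_ (fun i => ?_) i <;> refine Fin.lastCases ?_ (fun j => ?_) j
      · simp only [Fin.snoc_last, map_smul, LinearMap.smul_apply, smul_eq_mul, if_true, hself,
          mul_zero, and_true]
        linarith
      · have h3 : g v (e j) = 0 := by rw [symm]; exact h1 j
        have h4 : g v (J (e j)) = 0 := by
          have := hskew v (e j); rw [symm (J v), h2] at this; linarith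
        have hne : Fin.last m ≠ j.castSucc := (Fin.castSucc_lt_last j).ne'
        simp [h3, h4, hne]
      · have hne : i.castSucc ≠ Fin.last m := (Fin.castSucc_lt_last i).ne
        simp [h1, h2, hne]
      · simpa using he i j
  obtain ⟨e, he⟩ := key n le_rfl
  refine ⟨fun i => if (i : ℕ) % 2 = 0 then e ⟨i / 2, by omega⟩ else J (e ⟨i / 2, by omega⟩),
    fun i j => ?_, fun j => ?_⟩
  · have hij : (⟨(i : ℕ) / 2, by omega⟩ : Fin n) = ⟨(j : ℕ) / 2, by omega⟩ ↔
        (i : ℕ) / 2 = j / 2 := by simp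
    by_cases hi : (i : ℕ) % 2 = 0 <;> by_cases hj : (j : ℕ) % 2 = 0 <;>
      simp only [hi, hj, if_true, if_false, he, hg, hskew, hij, neg_zero]
    · congr 1; simp only [eq_iff_iff, Fin.ext_iff]; omega
    · rw [if_neg (by rw [Fin.ext_iff]; omega)]
    · rw [if_neg (by rw [Fin.ext_iff]; omega)]
    · congr 1; simp only [eq_iff_iff, Fin.ext_iff]; omega
  · have h1 : (2 * (j : ℕ) + 1) % 2 ≠ 0 := by omega
    have h2 : (2 * (j : ℕ)) % 2 = 0 := by omega
    have h3 : (⟨(2 * (j : ℕ) + 1) / 2, by omega⟩ : Fin n) = j := by ext; simp; omega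
    have h4 : (⟨(2 * (j : ℕ)) / 2, by omega⟩ : Fin n) = j := by ext; simp
    simp only [h1, h2, h3, h4, if_true, if_false]

/-- The volume form `b_0^* ∧ ⋯ ∧ b_{m-1}^*` of a `g`-orthonormal frame `b`, where
`b_i^* = g (b_i, ·)`. -/
def frameVolume {m : ℕ} (g : V →L[ℝ] V →L[ℝ] ℝ) (b : Fin m → V) : KForm V m :=
  wedgeCovectors fun i => Complex.ofRealCLM.comp (g (b i))

end Pointwise

/-! ### Almost-Hermitian manifolds -/

section Manifold

/-- An almost-Hermitian structure on a smooth `2n`-manifold `M`: a smooth almost complex structure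
`J` and a smooth Riemannian metric `g` with `g (J u) (J v) = g u v`. -/
structure AlmostHermitianStructure (n : ℕ) (M : Type*) [TopologicalSpace M]
    [ChartedSpace (EuclideanSpace ℝ (Fin (2 * n))) M] [IsManifold (𝓡 (2 * n)) ∞ M] where
  /-- the almost complex structure -/
  J : ∀ x : M, TangentSpace (𝓡 (2 * n)) x →L[ℝ] TangentSpace (𝓡 (2 * n)) x
  J_sq : ∀ x v, J x (J x v) = -v
  contMDiff_J : ContMDiff (𝓡 (2 * n))
    ((𝓡 (2 * n)).prod 𝓘(ℝ, EuclideanSpace ℝ (Fin (2 * n)) →L[ℝ] EuclideanSpace ℝ (Fin (2 * n)))) ∞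
    (fun x => Bundle.TotalSpace.mk'
      (E := fun x : M => TangentSpace (𝓡 (2 * n)) x →L[ℝ] TangentSpace (𝓡 (2 * n)) x)
      (EuclideanSpace ℝ (Fin (2 * n)) →L[ℝ] EuclideanSpace ℝ (Fin (2 * n))) x (J x))
  /-- the Riemannian metric -/
  g : Bundle.ContMDiffRiemannianMetric (𝓡 (2 * n)) ∞ (EuclideanSpace ℝ (Fin (2 * n)))
    (fun x : M => TangentSpace (𝓡 (2 * n)) x)
  g_J : ∀ x u v, g.inner x (J x u) (J x v) = g.inner x u v

variable {n : ℕ} {M : Type*} [TopologicalSpace M]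
    [ChartedSpace (EuclideanSpace ℝ (Fin (2 * n))) M]

/-- Complex differential forms on `M`, of all degrees simultaneously and without any regularity:
`α x k` is the degree `k` component of `α` at `x`. -/
abbrev FormField (n : ℕ) (M : Type*) [TopologicalSpace M]
    [ChartedSpace (EuclideanSpace ℝ (Fin (2 * n))) M] : Type _ :=
  ∀ x : M, Forms (TangentSpace (𝓡 (2 * n)) x)

/-- The expression of the degree `k` component of `α` in the preferred chart `φ` at `x₀`, i.e. the
pull-back of `α` by `φ⁻¹`; meaningful on the target of the chart. -/
def chartRep (x₀ : M) (α : FormField n M) (k : ℕ) (y : EuclideanSpace ℝ (Fin (2 * n))) :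
    EuclideanSpace ℝ (Fin (2 * n)) [⋀^Fin k]→L[ℝ] ℂ :=
  (α ((extChartAt (𝓡 (2 * n)) x₀).symm y) k).compContinuousLinearMap
    (mfderiv 𝓘(ℝ, EuclideanSpace ℝ (Fin (2 * n))) (𝓡 (2 * n))
      (extChartAt (𝓡 (2 * n)) x₀).symm y)

/-- A form is smooth if all its expressions in charts are smooth. -/
def IsSmooth (α : FormField n M) : Prop :=
  ∀ (x₀ : M) (k : ℕ), ContDiffOn ℝ ∞ (chartRep x₀ α k) (extChartAt (𝓡 (2 * n)) x₀).target

/-- The exterior derivative: `(dα)_x = φ^* (d ((φ⁻¹)^* α))` at `x`, where `φ` is the preferred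
chart at `x`. -/
def extD (α : FormField n M) : FormField n M
  | _, 0 => 0
  | x, k + 1 => (extDeriv (chartRep x α k) (extChartAt (𝓡 (2 * n)) x x)).compContinuousLinearMap
      (mfderiv (𝓡 (2 * n)) 𝓘(ℝ, EuclideanSpace ℝ (Fin (2 * n))) (extChartAt (𝓡 (2 * n)) x) x)

namespace AlmostHermitianStructure

variable [IsManifold (𝓡 (2 * n)) ∞ M] (X : AlmostHermitianStructure n M)

theorem inner_J_self (x : M) (u : TangentSpace (𝓡 (2 * n)) x) :
    X.g.inner x (X.J x u) u = 0 := by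
  have h1 := X.g_J x (X.J x u) u
  rw [X.J_sq, map_neg, neg_apply, X.g.symm x u] at h1
  linarith

/-- The fundamental form `(u, v) ↦ g (J u) v` at a point, as a complex-valued `2`-form. -/
def fundamentalForm (x : M) : KForm (TangentSpace (𝓡 (2 * n)) x) 2 where
  toFun v := (X.g.inner x (X.J x (v 0)) (v 1) : ℝ)
  map_update_add' v i a b := by
    fin_cases i <;> simp [Function.update]
  map_update_smul' v i c a := by
    fin_cases i <;> simp [Function.update]
  map_eq_zero_of_eq' v i j hv hij := by
    have h01 : v 0 = v 1 := by
      fin_cases i <;> fin_cases j <;> simp_all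
    simp [h01, X.inner_J_self]
  cont := by
    let g' : EuclideanSpace ℝ (Fin (2 * n)) →L[ℝ] EuclideanSpace ℝ (Fin (2 * n)) →L[ℝ] ℝ :=
      X.g.inner x
    let J' : EuclideanSpace ℝ (Fin (2 * n)) →L[ℝ] EuclideanSpace ℝ (Fin (2 * n)) := X.J x
    change Continuous fun v : Fin 2 → EuclideanSpace ℝ (Fin (2 * n)) =>
      ((g' (J' (v 0)) (v 1) : ℝ) : ℂ)
    fun_prop

theorem exists_frame (x : M) : ∃ b : Fin (2 * n) → TangentSpace (𝓡 (2 * n)) x,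
    IsUnitaryFrame (fun u v => X.g.inner x u v) (X.J x) b := by
  have hfd : FiniteDimensional ℝ (TangentSpace (𝓡 (2 * n)) x) :=
    inferInstanceAs (FiniteDimensional ℝ (EuclideanSpace ℝ (Fin (2 * n))))
  have hrank : Module.finrank ℝ (TangentSpace (𝓡 (2 * n)) x) = 2 * n :=
    finrank_euclideanSpace_fin (𝕜 := ℝ) (n := 2 * n)
  exact exists_isUnitaryFrame hrank
    ((ContinuousLinearMap.coeLM ℝ).comp (X.g.inner x).toLinearMap) (X.J x).toLinearMap
    (X.g.symm x) (X.g.pos x) (X.J_sq x) (X.g_J x)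

/-- A unitary frame of the tangent space at `x`; the Hodge star does not depend on the choice. -/
def frame (x : M) : Fin (2 * n) → TangentSpace (𝓡 (2 * n)) x :=
  Classical.choose (X.exists_frame x)

theorem isUnitaryFrame_frame (x : M) :
    IsUnitaryFrame (fun u v => X.g.inner x u v) (X.J x) (X.frame x) :=
  Classical.choose_spec (X.exists_frame x)

/-- The `ℂ`-linear Hodge star `*` of the metric `g` and the orientation induced by `J`. -/
def star (α : FormField n M) : FormField n M := fun x =>
  hodgeStar (X.frame x) (frameVolume (X.g.inner x) (X.frame x)) (α x)

/-- The Lefschetz operator `L α = fundamental form ∧ α`. -/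
def L (α : FormField n M) : FormField n M := fun x => lefschetz (X.fundamentalForm x) (α x)

/-- The dual Lefschetz operator `Λ = - * L *`. On `k`-forms it differs from the pointwise adjoint
`(-1)^k * L *` of `L` at most by a sign, so the kernel in each degree is the same. -/
def dualL (α : FormField n M) : FormField n M := -X.star (X.L (X.star α))

/-- The component of bidegree `(p,q)` of a form. -/
def bidegreePart (p q : ℕ) (α : FormField n M) : FormField n M := fun x k =>
  if p + q = k then typeProj (X.J x) p q (α x k) else 0

/-- The operator `∂`: on forms of bidegree `(p,q)` it is the component of bidegree `(p+1,q)`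
of `d`. -/
def del (α : FormField n M) : FormField n M
  | _, 0 => 0
  | x, k + 1 => ∑ pq ∈ Finset.HasAntidiagonal.antidiagonal k,
      X.bidegreePart (pq.1 + 1) pq.2 (extD (X.bidegreePart pq.1 pq.2 α)) x (k + 1)

/-- The operator `∂̄`: on forms of bidegree `(p,q)` it is the component of bidegree `(p,q+1)`
of `d`. -/
def delbar (α : FormField n M) : FormField n M
  | _, 0 => 0
  | x, k + 1 => ∑ pq ∈ Finset.HasAntidiagonal.antidiagonal k,
      X.bidegreePart pq.1 (pq.2 + 1) (extD (X.bidegreePart pq.1 pq.2 α)) x (k + 1)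

/-- `∂^* = - * ∂̄ *`. -/
def delStar (α : FormField n M) : FormField n M := -X.star (X.delbar (X.star α))

/-- `∂̄^* = - * ∂ *`. -/
def delbarStar (α : FormField n M) : FormField n M := -X.star (X.del (X.star α))

/-- The Laplacian `Δ_∂ = ∂ ∂^* + ∂^* ∂`. -/
def laplaceDel (α : FormField n M) : FormField n M :=
  X.del (X.delStar α) + X.delStar (X.del α)

/-- The Laplacian `Δ_∂̄ = ∂̄ ∂̄^* + ∂̄^* ∂̄`. -/
def laplaceDelbar (α : FormField n M) : FormField n M :=
  X.delbar (X.delbarStar α) + X.delbarStar (X.delbar α)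

/-- `A^{p,q}(X)`: the smooth forms of bidegree `(p,q)`. -/
def smoothForms (p q : ℕ) : Set (FormField n M) :=
  {α | IsSmooth α ∧ ∀ x, α x (p + q) ∈ typeSubmodule (X.J x) p q ∧ ∀ k, k ≠ p + q → α x k = 0}

/-- `H^{p,q}_∂`: the `∂`-harmonic forms of bidegree `(p,q)`. -/
def harmonicDel (p q : ℕ) : Set (FormField n M) :=
  {α | α ∈ X.smoothForms p q ∧ X.laplaceDel α = 0}

/-- `H^{p,q}_∂̄`: the `∂̄`-harmonic forms of bidegree `(p,q)`. -/
def harmonicDelbar (p q : ℕ) : Set (FormField n M) :=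
  {α | α ∈ X.smoothForms p q ∧ X.laplaceDelbar α = 0}

/-- `P^{p,q}`: the (smooth) primitive forms of bidegree `(p,q)`, i.e. those with `Λ α = 0`. -/
def primitiveForms (p q : ℕ) : Set (FormField n M) :=
  {α | α ∈ X.smoothForms p q ∧ X.dualL α = 0}

end AlmostHermitianStructure

end Manifold

end AlmostHermitian

end

/-! The reason is bidegree: `Λ` has bidegree `(-1,-1)`, so every `(p,0)`- or `(0,q)`-form is
primitive, and the harmonic forms lie among these. The argument is pointwise and establishes `ω ∧ *α
= 0` by evaluation on a unitary frame, without a bidegree calculus for `*`.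

A form of type `(p,0)` or `(0,q)` vanishes as soon as its arguments contain some `v` together with
`J v` (`eq_zero_of_mem_typeSubmodule`). The value of `*α` on frame vectors only involves values of
`α` on families containing all the frame vectors left out (`exists_of_hodgeStar_ne_zero`). In a term
of `(ω ∧ *α)(b_t)`, two frame vectors go into `ω` and are missing from the arguments of `*α`. If `ω`
is nonzero on them, one is `J` of the other, and `α` is evaluated on a family containing both, hence
is zero (`lefschetz_hodgeStar_eq_zero`). -/

namespace AlmostHermitian

section Pointwise

variable {V : Type*} [AddCommGroup V] [Module ℝ V] [TopologicalSpace V]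

/-! ### Vanishing of `(p,0)`- and `(0,q)`-forms on `J`-pairs -/

/-- If every covector `c i` is an eigenvector of precomposition with `J`, with the same
eigenvalue `e`, then their wedge product vanishes on families containing `v` and `J v`. -/
theorem wedgeCovectors_eq_zero_of_apply_eq {J : V → V} {k : ℕ} {c : Fin k → (V →L[ℝ] ℂ)} {e : ℂ}
    (hc : ∀ i v, c i (J v) = e * c i v) {v : Fin k → V} {i j : Fin k} (hij : i ≠ j)
    (hv : v j = J (v i)) : wedgeCovectors c v = 0 := by
  -- Column `j` equals `e` times column `i`, so subtracting that multiple makes it zero.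
  rw [wedgeCovectors_apply, ← Matrix.det_updateCol_add_smul_self _ hij.symm (-e)]
  refine Matrix.det_eq_zero_of_column_eq_zero j fun l => ?_
  simp [hv, hc]

/-- A form of type `(p,0)` or `(0,q)` vanishes on families containing `v` and `J v`. -/
theorem eq_zero_of_mem_typeSubmodule {J : V →L[ℝ] V} {p q : ℕ} (hpq : p = 0 ∨ q = 0)
    {α : KForm V (p + q)} (hα : α ∈ typeSubmodule J p q) {v : Fin (p + q) → V}
    {i j : Fin (p + q)} (hij : i ≠ j) (hv : v j = J (v i)) : α v = 0 := by
  induction hα using Submodule.span_induction with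
  | mem α hα =>
    obtain ⟨a, c, ha, hc, rfl⟩ := hα
    -- One block of `Fin.append a c` is empty, so all covectors share the eigenvalue `-i` (if `p =
    -- 0`) or `i` (if `q = 0`).
    rcases hpq with rfl | rfl
    · refine wedgeCovectors_eq_zero_of_apply_eq (J := J) (e := -Complex.I) (fun l u => ?_) hij hv
      refine Fin.addCases (fun l => l.elim0) (fun l => ?_) l
      simp only [Fin.append_right, hc]
    · refine wedgeCovectors_eq_zero_of_apply_eq (J := J) (e := Complex.I) (fun l u => ?_) hij hv
      refine Fin.addCases (fun l => ?_) (fun l => l.elim0) l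
      simp only [Fin.append_left, ha]
  | zero => rfl
  | add x y _ _ hx hy =>
    rw [ContinuousAlternatingMap.add_apply, hx, hy, add_zero]
  | smul t x _ hx => rw [ContinuousAlternatingMap.smul_apply, hx, smul_zero]

/-! ### Frame vectors on which the Hodge star can be nonzero -/

/-- Contracting with frame vectors `b_j`, `j ∈ l`: if `β` is nonzero only on families of frame
vectors that, together with the `b_i`, `i ∈ A`, exhaust the frame, then the same holds for the
contraction with `A` enlarged by `l`. -/
theorem mem_or_mem_range_of_contract_ne_zero {m : ℕ} {b : Fin m → V} (l : List (Fin m))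
    {β : Forms V} {A : Set (Fin m)}
    (hβ : ∀ (k : ℕ) (u : Fin k → Fin m), β k (b ∘ u) ≠ 0 → ∀ i, i ∈ A ∨ i ∈ Set.range u)
    {k : ℕ} {u : Fin k → Fin m} (h : contract (l.map b) β k (b ∘ u) ≠ 0) (i : Fin m) :
    i ∈ A ∨ i ∈ l ∨ i ∈ Set.range u := by
  induction l generalizing β A with
  | nil => simpa using hβ k u h i
  | cons j l ih =>
    -- `contract` is a left fold: the head `b j` is inserted into `β` first, and `j` moves into the
    -- set of indices already used.
    have := ih (β := fun k => interiorProd (b j) (β (k + 1))) (A := insert j A) ?_ h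
    · simp only [Set.mem_insert_iff, List.mem_cons] at this ⊢
      tauto
    · intro k u hu i
      have hcons : Matrix.vecCons (b j) (b ∘ u) = b ∘ Matrix.vecCons j u := by
        ext x; refine Fin.cases ?_ (fun _ => ?_) x <;> simp
      have hu' : β (k + 1) (Matrix.vecCons (b j) (b ∘ u)) ≠ 0 := hu
      rw [hcons] at hu'
      have := hβ _ _ hu' i
      simp only [Matrix.range_cons, Set.mem_union, Set.mem_singleton_iff,
        Set.mem_insert_iff] at this ⊢
      tauto

variable {n : ℕ} {g : V →L[ℝ] V →L[ℝ] ℝ} {J : V →L[ℝ] V} {b : Fin (2 * n) → V}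

/-- By orthonormality, an index `i` missed by `u` gives a zero row in the determinant `det (g (b_i,
b_{u j}))`. This is the starting point, with `A = ∅`, for the contraction lemma. -/
theorem surjective_of_single_frameVolume_ne_zero
    (hb : ∀ i j, g (b i) (b j) = if i = j then 1 else 0) {k : ℕ} {u : Fin k → Fin (2 * n)}
    (h : (Pi.single (2 * n) (frameVolume g b) : Forms V) k (b ∘ u) ≠ 0) (i : Fin (2 * n)) :
    i ∈ Set.range u := by
  by_contra hi
  obtain rfl : k = 2 * n := by
    by_contra hk
    rw [Pi.single_eq_of_ne hk] at h
    exact h rfl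
  rw [Pi.single_eq_same, frameVolume, wedgeCovectors_apply] at h
  refine h (Matrix.det_eq_zero_of_row_eq_zero i fun j => ?_)
  have hij : i ≠ u j := fun hij => hi ⟨j, hij.symm⟩
  simp [hb, hij]

/-- Some summand `α (b_s) * vol (b_s, b_u)` of the star must be nonzero, and the volume form
vanishes unless `s` and `u` together exhaust the frame. -/
theorem exists_of_hodgeStar_ne_zero
    (hb : ∀ i j, g (b i) (b j) = if i = j then 1 else 0) {α : Forms V} {k : ℕ}
    {u : Fin k → Fin (2 * n)} (h : hodgeStar b (frameVolume g b) α k (b ∘ u) ≠ 0) :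
    ∃ (a : ℕ) (s : Fin a → Fin (2 * n)), α a (b ∘ s) ≠ 0 ∧
      ∀ i, i ∈ Set.range s ∨ i ∈ Set.range u := by
  contrapose! h
  simp only [hodgeStar, Finset.sum_apply, Pi.smul_apply, ContinuousAlternatingMap.sum_apply,
    ContinuousAlternatingMap.smul_apply]
  refine Finset.sum_eq_zero fun a _ => ?_
  rw [Finset.sum_eq_zero, smul_zero]
  intro s _
  by_cases hs : α a (b ∘ s) = 0
  · rw [hs, zero_smul]
  · obtain ⟨i, hi1, hi2⟩ := h a s hs
    rw [← List.map_ofFn]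
    by_contra hne
    have := mem_or_mem_range_of_contract_ne_zero (A := ∅) (List.ofFn s)
      (fun k u hu i => Or.inr (surjective_of_single_frameVolume_ne_zero hb hu i))
      (right_ne_zero_of_smul hne) i
    simp only [Set.mem_empty_iff_false, false_or, List.mem_ofFn] at this
    exact this.elim hi1 hi2

/-! ### Vanishing of `ω ∧ *α` -/

/-- `J` permutes the frame up to sign, so orthonormality identifies `b j`. For even `i`, `J (b i)`
is the next frame vector; for odd `i`, it is minus the previous one, which gives the second
alternative. -/
theorem IsUnitaryFrame.eq_apply_or_eq_apply (hb : IsUnitaryFrame (fun u v => g u v) J b)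
    (hJ : ∀ v, J (J v) = -v) {i j : Fin (2 * n)} (h : g (J (b i)) (b j) ≠ 0) :
    b j = J (b i) ∨ b i = J (b j) := by
  have horth : ∀ i j, g (b i) (b j) = if i = j then 1 else 0 := hb.1
  have hbJ := hb.2
  rcases Nat.even_or_odd' (i : ℕ) with ⟨l, hl | hl⟩
  · have hi : b i = b ⟨2 * l, by omega⟩ := by congr 1; exact Fin.ext hl
    have hJi := hbJ ⟨l, by omega⟩
    rw [hi] at h ⊢
    left
    rw [← hJi] at h ⊢
    rw [horth] at h
    rw [← (ite_ne_right_iff.mp h).1]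
  · have hi : b i = b ⟨2 * l + 1, by omega⟩ := by congr 1; exact Fin.ext hl
    have hJi := hbJ ⟨l, by omega⟩
    rw [hi] at h ⊢
    right
    rw [hJi, hJ, map_neg, neg_apply, horth] at h
    rw [← (ite_ne_right_iff.mp (neg_ne_zero.mp h)).1, ← hJi]

theorem IsUnitaryFrame.linearIndependent (hb : IsUnitaryFrame (fun u v => g u v) J b) :
    LinearIndependent ℝ b := by
  rw [Fintype.linearIndependent_iff]
  intro c hc i
  have := congrArg (g (b i)) hc
  simpa [hb.1] using this

/-- `ω ∧ * α = 0` whenever `α` vanishes on all families containing `v` and `J v`. -/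
theorem lefschetz_hodgeStar_eq_zero [FiniteDimensional ℝ V]
    (hn : Module.finrank ℝ V = 2 * n) (hb : IsUnitaryFrame (fun u v => g u v) J b)
    (hJ : ∀ v, J (J v) = -v) {om : KForm V 2} (hom : ∀ v, om v = (g (J (v 0)) (v 1) : ℝ))
    {α : Forms V}
    (hα : ∀ (k : ℕ) (v : Fin k → V) (i j : Fin k), i ≠ j → v j = J (v i) → α k v = 0) :
    lefschetz om (hodgeStar b (frameVolume g b) α) = 0 := by
  funext k
  match k with
  | 0 => rfl
  | 1 => rfl
  | k + 2 =>
    let B : Module.Basis (Fin (2 * n)) ℝ V := .mk hb.linearIndependent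
      (hb.linearIndependent.span_eq_top_of_card_eq_finrank' (by simp [hn])).ge
    have hB : ∀ i, B i = b i := fun i => Module.Basis.mk_apply _ _ i
    -- An alternating map is determined by its values on injective families of basis vectors; the
    -- injectivity `ht` is what separates the arguments of `ω` from those of `*α`.
    apply ContinuousAlternatingMap.toAlternatingMap_injective
    refine B.ext_alternating fun t ht => ?_
    simp only [hB]
    change wedge (Nat.add_comm 2 k) om (hodgeStar b (frameVolume g b) α k) (b ∘ t) = 0
    rw [wedge, ContinuousAlternatingMap.smul_apply,
      ContinuousMultilinearMap.alternatization_apply_apply, Finset.sum_eq_zero, smul_zero]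
    intro σ _
    -- The sign of `σ` is a unit and can be dropped.
    rw [smul_eq_zero_iff_eq, tensorForm_apply]
    by_contra hne
    set p0 : Fin (k + 2) := Fin.cast (Nat.add_comm 2 k) (Fin.castAdd k 0) with hp0
    set p1 : Fin (k + 2) := Fin.cast (Nat.add_comm 2 k) (Fin.castAdd k 1) with hp1
    have h01 : t (σ p0) ≠ t (σ p1) := fun h => by
      simpa [hp0, hp1, Fin.ext_iff] using σ.injective (ht h)
    have hω := left_ne_zero_of_mul hne
    rw [hom, Complex.ofReal_ne_zero] at hω
    obtain ⟨a, s, hs, hcover⟩ := exists_of_hodgeStar_ne_zero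
      (u := fun x => t (σ (Fin.cast (Nat.add_comm 2 k) (Fin.natAdd 2 x)))) hb.1
      (right_ne_zero_of_mul hne)
    -- The two arguments of `ω` sit in positions below `2` and those of `*α` in positions from `2`
    -- on. Since `t ∘ σ` is injective, the former can only be covered by `s`.
    have hrest : ∀ y : Fin 2, t (σ (Fin.cast (Nat.add_comm 2 k) (Fin.castAdd k y))) ∈
        Set.range s := by
      intro y
      refine (hcover _).resolve_right ?_
      rintro ⟨x, hx⟩
      have := congrArg Fin.val (σ.injective (ht hx))
      simp only [Fin.val_cast, Fin.val_natAdd, Fin.val_castAdd] at this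
      omega
    obtain ⟨i, hi⟩ := hrest 0
    obtain ⟨j, hj⟩ := hrest 1
    have hij : i ≠ j := by
      rintro rfl
      exact h01 (hi.symm.trans hj)
    have hpair : b (s j) = J (b (s i)) ∨ b (s i) = J (b (s j)) := by
      rw [hi, hj]
      exact hb.eq_apply_or_eq_apply hJ hω
    rcases hpair with h | h
    · exact hs (hα a _ i j hij h)
    · exact hs (hα a _ j i hij.symm h)

theorem hodgeStar_zero {m : ℕ} (b : Fin m → V) (vol : KForm V m) : hodgeStar b vol 0 = 0 := by
  refine Finset.sum_eq_zero fun a _ => ?_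
  rw [Finset.sum_eq_zero, smul_zero]
  exact fun s _ => zero_smul ℂ (contract (List.ofFn (b ∘ s)) (Pi.single m vol))

end Pointwise

/-! ### Passage to the manifold -/

namespace AlmostHermitianStructure

variable {n : ℕ} {M : Type*} [TopologicalSpace M]
    [ChartedSpace (EuclideanSpace ℝ (Fin (2 * n))) M] [IsManifold (𝓡 (2 * n)) ∞ M]
    (X : AlmostHermitianStructure n M)

theorem star_zero : X.star 0 = 0 :=
  funext fun _ => hodgeStar_zero _ _

/-- Every form of type `(p,0)` or `(0,q)` is primitive. -/
theorem smoothForms_subset_primitiveForms {p q : ℕ} (hpq : p = 0 ∨ q = 0) :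
    X.smoothForms p q ⊆ X.primitiveForms p q := by
  intro α hα
  refine ⟨hα, ?_⟩
  have hL : X.L (X.star α) = 0 := by
    funext x
    have : FiniteDimensional ℝ (TangentSpace (𝓡 (2 * n)) x) :=
      inferInstanceAs (FiniteDimensional ℝ (EuclideanSpace ℝ (Fin (2 * n))))
    refine lefschetz_hodgeStar_eq_zero (finrank_euclideanSpace_fin (𝕜 := ℝ) (n := 2 * n))
      (X.isUnitaryFrame_frame x) (X.J_sq x) (fun _ => rfl) fun k v i j hij hv => ?_
    by_cases hk : k = p + q
    · subst hk
      exact eq_zero_of_mem_typeSubmodule hpq (hα.2 x).1 hij hv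
    · rw [(hα.2 x).2 k hk]
      rfl
  rw [dualL, hL, star_zero, neg_zero]

end AlmostHermitianStructure

end AlmostHermitian

theorem proposition3p1 (n : ℕ) (hn : 2 ≤ n) {M : Type*} [TopologicalSpace M] [T2Space M]
    [CompactSpace M] [ChartedSpace (EuclideanSpace ℝ (Fin (2 * n))) M]
    [IsManifold (𝓡 (2 * n)) ∞ M] (X : AlmostHermitian.AlmostHermitianStructure n M)
    (p q : ℕ) (hp : p ≤ n) (hq : q ≤ n) :
    X.harmonicDelbar p 0 = X.harmonicDelbar p 0 ∩ X.primitiveForms p 0 ∧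
    X.harmonicDelbar 0 q = X.harmonicDelbar 0 q ∩ X.primitiveForms 0 q ∧
    X.harmonicDel p 0 = X.harmonicDel p 0 ∩ X.primitiveForms p 0 ∧
    X.harmonicDel 0 q = X.harmonicDel 0 q ∩ X.primitiveForms 0 q := by

  -- Each equality `H = H ∩ P` amounts to `H ⊆ P`, and `hα.1` records the bidegree of a harmonic
  -- form.
  refine ⟨?_, ?_, ?_, ?_⟩ <;> symm <;> refine Set.inter_eq_left.mpr fun α hα => ?_
  · exact X.smoothForms_subset_primitiveForms (.inr rfl) hα.1
  · exact X.smoothForms_subset_primitiveForms (.inl rfl) hα.1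
  · exact X.smoothForms_subset_primitiveForms (.inr rfl) hα.1
  · exact X.smoothForms_subset_primitiveForms (.inl rfl) hα.1
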